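/- A partitioned set is a set $X$ with an equivalence relation $\sim_X$; a morphism $X\to Y$ of partitioned sets is a map of sets taking equivalent elements to equivalent elements. Let $\mathcal E$ be the category of partitioned sets. A morphism $f:X\to Y$ in $\mathcal E$ is called a weak equivalence if it induces a bijection $X/{\sim_X}\to Y/{\sim_Y}$ of quotient sets, and a fibration if it maps each equivalence class of $X$ onto an equivalence class of $Y$. Let $\mathcal C$ be a small category, and let $\mathcal E^{\mathcal C^{\mathrm{op}}}$ be the category of presheaves of partitioned sets (that is, of equivalence relations) on $\mathcal C$. Call a morphism $f$ of $\mathcal E^{\mathcal C^{\mathrm{op}}}$ a weak equivalence (respectively a fibration) if $f_C$ is a weak equivalence (respectively a fibration) in $\mathcal E$ for every object $C$ of $\mathcal C$; call it a cofibration if it has the left lifting property with respect to all morphisms that are both fibrations and weak equivalences. Then: 1. With these three classes, $\mathcal E^{\mathcal C^{\mathrm{op}}}$ is a model category: it has all small limits and colimits; weak equivalences have the two-out-of-three property; each of the three classes is closed under retracts; cofibrations have the left lifting property with respect to acyclic fibrations, and acyclic cofibrations with respect to fibrations; and every morphism factors functorially as a cofibration followed by an acyclic fibration, and as an acyclic cofibration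 followed by a fibration. (Acyclic means being also a weak equivalence.) 2. This model structure is proper: the pushout of a weak equivalence along a cofibration is a weak equivalence, and the pullback of a weak equivalence along a fibration is a weak equivalence. 3. It is cofibrantly generated: there are sets $I$ and $J$ of morphisms such that the acyclic fibrations are precisely the morphisms with the right lifting property with respect to $I$, the fibrations are precisely the morphisms with the right lifting property with respect to $J$, and both $I$ and $J$ permit the small object argument, in the sense that the domains of the elements of $I$ (respectively $J$) are small relative to the transfinite compositions of pushouts of elements of $I$ (respectively $J$). Here an object $A$ is small relative to a class $P$ of morphisms if there is a cardinal $\kappa$ such that for every regular cardinal $\mu\ge\kappa$ and every colimit-preserving sequence $(X_\beta)_{\beta<\mu}$ whose maps $X_\beta\to X_{\beta+1}$ all lie in $P$, the canonical map $\operatorname{colim}_{\beta<\mu}\operatorname{hom}(A,X_\beta)\to\operatorname{hom}(A,\operatorname{colim}_{\beta<\mu}X_\beta)$ is bijective. 4. The category $\mathcal E^{\mathcal C^{\mathrm{op}}}$ is locally finitely presentable. Hence the model structure is combinatorial, that is, cofibrantly generated with a locally presentable underlying category. -/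

import Mathlib

open CategoryTheory Limits HomotopicalAlgebra

universe u

/-- A partitioned set: a (small) set together with an equivalence relation on it. -/
structure PartitionedSet : Type (u + 1) where
  /-- the underlying set -/
  carrier : Type u
  /-- the equivalence relation -/
  rel : Setoid carrier

namespace PartitionedSet

/-- A morphism of partitioned sets is a map that takes equivalent elements to equivalent
elements. -/
@[ext]
structure Hom (X Y : PartitionedSet.{u}) : Type u where
  /-- the underlying map -/
  toFun : X.carrier → Y.carrier
  map_rel : ∀ x x' : X.carrier, X.rel x x' → Y.rel (toFun x) (toFun x')

/-- The category of partitioned sets. -/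
instance : Category.{u} PartitionedSet.{u} where
  Hom X Y := Hom X Y
  id X := ⟨fun x => x, fun _ _ h => h⟩
  comp f g := ⟨fun x => g.toFun (f.toFun x), fun _ _ h => g.map_rel _ _ (f.map_rel _ _ h)⟩

/-- The map of quotient sets induced by a morphism of partitioned sets. -/
def quotientMap {X Y : PartitionedSet.{u}} (f : X ⟶ Y) : Quotient X.rel → Quotient Y.rel :=
  Quotient.map (Hom.toFun f) (fun x x' h => Hom.map_rel f x x' h)

/-- A morphism is a weak equivalence if it induces a bijection of quotient sets. -/
def weakEquivalence : MorphismProperty PartitionedSet.{u} :=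
  fun _ _ f => Function.Bijective (quotientMap f)

/-- A morphism is a fibration if it maps each class of the source onto a class of the
target. -/
def fibration : MorphismProperty PartitionedSet.{u} :=
  fun X Y f => ∀ s ∈ X.rel.classes, Hom.toFun f '' s ∈ Y.rel.classes

end PartitionedSet

section ModelStructures

universe v w

variable {D : Type w} [Category.{v} D]

/-- Let `P` be a class of morphisms of `D`. The object `A` is small relative to `P` if there is
a cardinal `κ` such that, for every regular cardinal `μ ≥ κ` and every `μ`-sequence `F` in `D`
(a functor on the ordinal `μ` that is continuous at limit ordinals) all of whose successor maps
`F β ⟶ F (β + 1)` belong to `P`, the functor `Hom(A, -)` preserves the colimit of `F`. -/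
def IsSmallRelativeTo (A : D) (P : MorphismProperty D) : Prop :=
  ∃ κ : Cardinal.{v}, ∀ μ : Cardinal.{v}, μ.IsRegular → κ ≤ μ →
    ∀ F : μ.ord.ToType ⥤ D, F.IsWellOrderContinuous →
      (∀ (β γ : μ.ord.ToType) (h : β ⋖ γ), P (F.map (homOfLE h.le))) →
        PreservesColimit F (coyoneda.obj (Opposite.op A))

/-- Relative `I`-cell complexes: transfinite compositions of pushouts of elements of `I`. -/
def relativeCellComplexes (I : MorphismProperty D) : MorphismProperty D :=
  MorphismProperty.transfiniteCompositions.{v} I.pushouts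

/-- `I` permits the small object argument if the domains of the elements of `I` are small
relative to the class of relative `I`-cell complexes. -/
def PermitsSmallObjectArgument (I : MorphismProperty D) : Prop :=
  ∀ ⦃A B : D⦄ (i : A ⟶ B), I i → IsSmallRelativeTo A (relativeCellComplexes I)

variable (D)

/-- A model structure is left proper if the pushout of a weak equivalence along a cofibration
is a weak equivalence. -/
def IsLeftProper [ModelCategory D] : Prop :=
  ∀ ⦃A B A' B' : D⦄ (f : A ⟶ B) (i : A ⟶ A') (j : B ⟶ B') (f' : A' ⟶ B'),
    IsPushout f i j f' → weakEquivalences D f → cofibrations D i → weakEquivalences D f'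

/-- A model structure is right proper if the pullback of a weak equivalence along a fibration
is a weak equivalence. -/
def IsRightProper [ModelCategory D] : Prop :=
  ∀ ⦃X Y X' Y' : D⦄ (f' : X' ⟶ Y') (q : X' ⟶ X) (p : Y' ⟶ Y) (f : X ⟶ Y),
    IsPullback f' q p f → weakEquivalences D f → fibrations D p → weakEquivalences D f'

/-- A model structure is proper if it is both left proper and right proper. -/
def IsProperModelStructure [ModelCategory D] : Prop :=
  IsLeftProper D ∧ IsRightProper D

/-- A model structure is cofibrantly generated if there are sets of morphisms `I` and `J`, both
permitting the small object argument, such that the acyclic fibrations are the morphisms with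
the right lifting property with respect to `I`, and the fibrations are the morphisms with the
right lifting property with respect to `J`. -/
def IsCofibrantlyGenerated [ModelCategory D] : Prop :=
  (∃ I : MorphismProperty D, MorphismProperty.IsSmall.{v} I ∧ PermitsSmallObjectArgument I ∧
    trivialFibrations D = I.rlp) ∧
  (∃ J : MorphismProperty D, MorphismProperty.IsSmall.{v} J ∧ PermitsSmallObjectArgument J ∧
    fibrations D = J.rlp)

/-- A model structure is combinatorial if it is cofibrantly generated and the underlying
category is locally presentable. -/
def IsCombinatorial [ModelCategory D] : Prop :=
  IsLocallyPresentable.{v} D ∧ IsCofibrantlyGenerated D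

end ModelStructures

namespace PartitionedSet

/-! Weak equivalences are the maps inverted by the quotient functor, a left adjoint of the discrete
functor. This gives two-out-of-three, and left properness because left adjoints preserve pushouts.
Fibrations lift against the inclusion of a point into `pair`. Acyclic fibrations are the surjections
reflecting the relation, so they lift against `emptyToPoint` and `discreteToPair`. The left adjoints
of evaluation carry these generators to diagrams; their domains stay finitely presentable, so the
small object argument applies. The remaining compatibility is that maps lifting against all
fibrations are weak equivalences (`llp_fibration_le_weakEquivalence`); a retract argument then
identifies the acyclic cofibrations. Right properness is checked objectwise, and local finite
presentability comes from the strong generator `pair`. -/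

/-- Constructor for morphisms of partitioned sets. -/
def homMk {X Y : PartitionedSet.{u}} (f : X.carrier → Y.carrier)
    (hf : ∀ x x', X.rel x x' → Y.rel (f x) (f x')) : X ⟶ Y :=
  Hom.mk f hf

@[ext]
lemma hom_ext {X Y : PartitionedSet.{u}} {f g : X ⟶ Y}
    (h : ∀ x, Hom.toFun f x = Hom.toFun g x) : f = g :=
  Hom.ext (funext h)

@[simp]
lemma id_toFun (X : PartitionedSet.{u}) (x : X.carrier) : Hom.toFun (𝟙 X) x = x := rfl

@[simp]
lemma comp_toFun {X Y Z : PartitionedSet.{u}} (f : X ⟶ Y) (g : Y ⟶ Z) (x : X.carrier) :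
    Hom.toFun (f ≫ g) x = Hom.toFun g (Hom.toFun f x) := rfl

lemma congr_toFun {X Y : PartitionedSet.{u}} {f g : X ⟶ Y} (h : f = g) (x : X.carrier) :
    Hom.toFun f x = Hom.toFun g x := by rw [h]

lemma rel_congr {X : PartitionedSet.{u}} {x x' y y' : X.carrier} (hx : x = x') (hy : y = y')
    (h : X.rel x' y') : X.rel x y := by
  rwa [hx, hy]

/-! ### Adjunctions with the category of sets -/

/-- The underlying set of a partitioned set. -/
def forget : PartitionedSet.{u} ⥤ Type u where
  obj X := X.carrier
  map f := ↾(Hom.toFun f)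

/-- A set with the discrete equivalence relation. -/
def discrete : Type u ⥤ PartitionedSet.{u} where
  obj S := ⟨S, ⊥⟩
  map f := homMk (fun x => f x) (by rintro x _ rfl; rfl)

/-- A set with the equivalence relation that has one class. -/
def indiscrete : Type u ⥤ PartitionedSet.{u} where
  obj S := ⟨S, ⊤⟩
  map f := homMk (fun x => f x) (fun _ _ _ => trivial)

/-- The quotient of a partitioned set by its equivalence relation. -/
def quotient : PartitionedSet.{u} ⥤ Type u where
  obj X := Quotient X.rel
  map f := ↾(quotientMap f)
  map_id X := by ext x; induction x using Quotient.inductionOn; rfl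
  map_comp f g := by ext x; induction x using Quotient.inductionOn; rfl

/-- The quotient functor is left adjoint to the discrete functor. -/
def quotientAdjunction : quotient.{u} ⊣ discrete :=
  Adjunction.mkOfHomEquiv
    { homEquiv X S :=
        { toFun f := homMk (fun x => f (Quotient.mk X.rel x))
            (fun x x' h => congrArg f (Quotient.sound h))
          invFun g := ↾(Quotient.lift (Hom.toFun g) (fun x x' h => Hom.map_rel g x x' h))
          left_inv f := by ext x; induction x using Quotient.inductionOn; rfl
          right_inv g := rfl }
      homEquiv_naturality_left_symm f g := by
        ext x; induction x using Quotient.inductionOn; rfl }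

/-- The discrete functor is left adjoint to the underlying set functor. -/
def discreteAdjunction : discrete.{u} ⊣ forget :=
  Adjunction.mkOfHomEquiv
    { homEquiv S X :=
        { toFun f := ↾(Hom.toFun f)
          invFun g := homMk (fun x => g x) (by rintro x _ rfl; exact X.rel.refl _)
          left_inv f := rfl
          right_inv g := rfl } }

/-- The underlying set functor is left adjoint to the indiscrete functor. -/
def forgetAdjunction : forget.{u} ⊣ indiscrete :=
  Adjunction.mkOfHomEquiv
    { homEquiv X S :=
        { toFun f := homMk (fun x => f x) (fun _ _ _ => trivial)
          invFun g := ↾(Hom.toFun g)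
          left_inv f := rfl
          right_inv g := rfl } }

instance : quotient.{u}.IsLeftAdjoint := ⟨_, ⟨quotientAdjunction⟩⟩

instance : forget.{u}.IsLeftAdjoint := ⟨_, ⟨forgetAdjunction⟩⟩

instance : forget.{u}.IsRightAdjoint := ⟨_, ⟨discreteAdjunction⟩⟩

/-! ### Limits and colimits -/

section Limits

variable {J : Type u} [SmallCategory J] (F : J ⥤ PartitionedSet.{u})

/-- The limit of a diagram: compatible families, compared componentwise. -/
def limitCone : Cone F where
  pt :=
    { carrier := { x : ∀ j, (F.obj j).carrier //
        ∀ ⦃i j : J⦄ (f : i ⟶ j), Hom.toFun (F.map f) (x i) = x j }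
      rel :=
        { r x y := ∀ j, (F.obj j).rel (x.1 j) (y.1 j)
          iseqv := ⟨fun _ _ => Setoid.refl' _ _, fun h j => Setoid.symm' _ (h j),
            fun h h' j => Setoid.trans' _ (h j) (h' j)⟩ } }
  π :=
    { app j := homMk (fun x => x.1 j) (fun _ _ h => h j)
      naturality i j f := by ext x; exact (x.2 f).symm }

/-- The universal property of `limitCone`. -/
def limitConeIsLimit : IsLimit (limitCone F) where
  lift s := homMk (fun x => ⟨fun j => Hom.toFun (s.π.app j) x,
    fun i j f => congr_toFun (s.w f) x⟩) (fun x x' h j => Hom.map_rel (s.π.app j) x x' h)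
  fac s j := rfl
  uniq s m hm := by
    ext x
    exact Subtype.ext (funext fun j => congr_toFun (hm j) x)

/-- The equivalence relation on the colimit of the underlying sets that is generated by the
equivalence relations of the diagram. -/
noncomputable def colimitSetoid : Setoid (colimit (F ⋙ forget) : Type u) :=
  sInf { s | ∀ (j : J) (x y : (F.obj j).carrier), (F.obj j).rel x y →
    s (colimit.ι (F ⋙ forget) j x) (colimit.ι (F ⋙ forget) j y) }

/-- The colimit of a diagram. -/
noncomputable def colimitCocone : Cocone F where
  pt := ⟨_, colimitSetoid F⟩
  ι :=
    { app j := homMk (fun x => colimit.ι (F ⋙ forget) j x)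
        (fun x y h s hs => hs j x y h)
      naturality i j f := by
        ext x
        exact ConcreteCategory.congr_hom (colimit.w (F ⋙ forget) f) x }

/-- The universal property of `colimitCocone`. -/
noncomputable def colimitCoconeIsColimit : IsColimit (colimitCocone F) where
  desc s := homMk (fun x => colimit.desc (F ⋙ forget) (forget.mapCocone s) x) (by
    intro x x' h
    -- The generated relation is the least one, so it lies in the pullback of the relation of
    -- `s.pt`.
    refine h (s.pt.rel.comap (fun x => colimit.desc (F ⋙ forget) (forget.mapCocone s) x)) ?_
    intro j y y' hy
    have w (z : (F.obj j).carrier) := ConcreteCategory.congr_hom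
      (colimit.ι_desc (forget.mapCocone s) j) z
    exact rel_congr (X := s.pt) (w y) (w y') (Hom.map_rel (s.ι.app j) y y' hy))
  fac s j := by
    ext x
    exact ConcreteCategory.congr_hom (colimit.ι_desc (forget.mapCocone s) j) x
  uniq s m hm := by
    have : forget.map m = colimit.desc (F ⋙ forget) (forget.mapCocone s) := by
      apply colimit.hom_ext
      intro j
      rw [colimit.ι_desc]
      exact congrArg forget.map (hm j)
    ext x
    exact ConcreteCategory.congr_hom this x

end Limits

instance : HasLimitsOfSize.{u, u} PartitionedSet.{u} :=
  ⟨fun _ _ => ⟨fun F => ⟨⟨_, limitConeIsLimit F⟩⟩⟩⟩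

instance : HasColimitsOfSize.{u, u} PartitionedSet.{u} :=
  ⟨fun _ _ => ⟨fun F => ⟨⟨_, colimitCoconeIsColimit F⟩⟩⟩⟩

/-! ### The finitely presentable strong generator -/

/-- The partitioned set with two equivalent elements. -/
abbrev pair : PartitionedSet.{u} := indiscrete.obj (ULift.{u} Bool)

/-- The morphism from `pair` that selects two equivalent elements. -/
def pairDesc {X : PartitionedSet.{u}} (x y : X.carrier) (h : X.rel x y) : pair ⟶ X :=
  homMk (fun b => bif b.down then y else x) (by
    rintro ⟨_ | _⟩ ⟨_ | _⟩ -
    exacts [X.rel.refl _, h, X.rel.symm h, X.rel.refl _])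

lemma rel_of_pair {X : PartitionedSet.{u}} (f : pair ⟶ X) (a b : pair.carrier) :
    X.rel (Hom.toFun f a) (Hom.toFun f b) :=
  Hom.map_rel f a b trivial

section FilteredColimits

variable {J : Type u} [SmallCategory J] [IsFiltered J] {F : J ⥤ PartitionedSet.{u}}
  {c : Cocone F} (hc : IsColimit c)

include hc

/-- In a filtered colimit, two elements are equivalent if and only if they are represented by
equivalent elements at some stage. -/
lemma exists_rel_of_isColimit {x y : c.pt.carrier} (hxy : c.pt.rel x y) :
    ∃ (j : J) (x' y' : (F.obj j).carrier), (F.obj j).rel x' y' ∧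
      Hom.toFun (c.ι.app j) x' = x ∧ Hom.toFun (c.ι.app j) y' = y := by
  have hU := isColimitOfPreserves forget hc
  have hmap {i j : J} (f : i ⟶ j) (z : (F.obj i).carrier) :
      Hom.toFun (c.ι.app j) (Hom.toFun (F.map f) z) = Hom.toFun (c.ι.app i) z :=
    congr_toFun (c.w f) z
  -- Once `r` is an equivalence relation, it makes the same underlying set a cocone point, and the
  -- induced map from the colimit is the identity on elements.
  let r : Setoid c.pt.carrier :=
    { r x y := ∃ (j : J) (x' y' : (F.obj j).carrier), (F.obj j).rel x' y' ∧
        Hom.toFun (c.ι.app j) x' = x ∧ Hom.toFun (c.ι.app j) y' = y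
      iseqv :=
        { refl x := by
            obtain ⟨j, x', hx'⟩ := Types.jointly_surjective_of_isColimit hU x
            exact ⟨j, x', x', Setoid.refl' _ _, hx', hx'⟩
          symm := by
            rintro x y ⟨j, x', y', h, hx, hy⟩
            exact ⟨j, y', x', Setoid.symm' _ h, hy, hx⟩
          trans := by
            rintro x y z ⟨j, x', y', h, hx, hy⟩ ⟨k, y'', z', h', hy', hz⟩
            -- The two representatives of the middle element become equal at a later stage, where
            -- the two relations can be composed.
            obtain ⟨l, f, g, hfg⟩ := (Types.FilteredColimit.isColimit_eq_iff _ hU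
              (xi := y') (xj := y'')).1 (hy.trans hy'.symm)
            refine ⟨l, Hom.toFun (F.map f) x', Hom.toFun (F.map g) z', ?_,
              (hmap f _).trans hx, (hmap g _).trans hz⟩
            refine Setoid.trans' _ (Hom.map_rel (F.map f) _ _ h) ?_
            have : Hom.toFun (F.map f) y' = Hom.toFun (F.map g) y'' := hfg
            rw [this]
            exact Hom.map_rel (F.map g) _ _ h' } }
  let s : Cocone F :=
    { pt := ⟨c.pt.carrier, r⟩
      ι :=
        { app j := homMk (X := F.obj j) (Y := ⟨c.pt.carrier, r⟩)
            (Hom.toFun (Y := c.pt) (c.ι.app j)) (fun x y h => ⟨j, x, y, h, rfl, rfl⟩)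
          naturality i j f := by ext x; exact hmap f x } }
  have hs (z : c.pt.carrier) : Hom.toFun (hc.desc s) z = z := by
    obtain ⟨j, z, rfl⟩ := Types.jointly_surjective_of_isColimit hU z
    exact congr_toFun (hc.fac s j) z
  have := Hom.map_rel (hc.desc s) x y hxy
  rwa [hs, hs] at this

end FilteredColimits

attribute [local instance] Cardinal.fact_isRegular_aleph0

/-- A map out of `pair` is an ordered pair of equivalent elements, and such data already exist at
some stage of a filtered colimit. -/
instance : IsFinitelyPresentable.{u} pair.{u} := by
  rw [isFinitelyPresentable_iff_preservesFilteredColimitsOfSize]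
  refine ⟨fun J _ _ => ⟨fun {F} => ⟨fun {c} hc => ⟨?_⟩⟩⟩⟩
  refine Types.FilteredColimit.isColimitOf' _ _ (fun f => ?_) (fun j f g hfg => ?_)
  · obtain ⟨j, x, y, h, hx, hy⟩ := exists_rel_of_isColimit hc (rel_of_pair f ⟨false⟩ ⟨true⟩)
    refine ⟨j, pairDesc x y h, ?_⟩
    refine hom_ext ?_
    rintro ⟨_ | _⟩
    exacts [hx.symm, hy.symm]
  · have hU := isColimitOfPreserves forget hc
    have h (b : pair.carrier) : ∃ (k : J) (φ : j ⟶ k),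
        Hom.toFun (F.map φ) (Hom.toFun f b) = Hom.toFun (F.map φ) (Hom.toFun g b) :=
      (Types.FilteredColimit.isColimit_eq_iff' hU (Hom.toFun f b) (Hom.toFun g b)).1
        (congr_toFun hfg b)
    obtain ⟨k₀, φ₀, h₀⟩ := h ⟨false⟩
    obtain ⟨k₁, φ₁, h₁⟩ := h ⟨true⟩
    obtain ⟨l, ψ₀, ψ₁, hl⟩ := IsFiltered.span φ₀ φ₁
    refine ⟨l, φ₀ ≫ ψ₀, ?_⟩
    refine hom_ext ?_
    rintro ⟨_ | _⟩
    · change Hom.toFun (F.map (φ₀ ≫ ψ₀)) _ = Hom.toFun (F.map (φ₀ ≫ ψ₀)) _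
      rw [F.map_comp, comp_toFun, comp_toFun, h₀]
    · change Hom.toFun (F.map (φ₀ ≫ ψ₀)) _ = Hom.toFun (F.map (φ₀ ≫ ψ₀)) _
      rw [hl, F.map_comp, comp_toFun, comp_toFun, h₁]

/-- The right adjoint `forget` of `discrete` preserves colimits, so `discrete` preserves
presentability. -/
instance isFinitelyPresentable_discrete (S : Type u) [Finite S] :
    IsFinitelyPresentable.{u} (discrete.obj S) := by
  have : IsCardinalPresentable S Cardinal.aleph0.{u} :=
    (Types.isCardinalPresentable_iff _).2 (hasCardinalLT_of_finite _ _ le_rfl)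
  exact discreteAdjunction.isCardinalPresentable_leftAdjoint_obj _ S

lemma isIso_iff {X Y : PartitionedSet.{u}} (f : X ⟶ Y) :
    IsIso f ↔ Function.Bijective (Hom.toFun f) ∧
      ∀ x x', Y.rel (Hom.toFun f x) (Hom.toFun f x') → X.rel x x' := by
  refine ⟨fun _ => ⟨⟨fun x x' h => ?_, fun y => ⟨Hom.toFun (inv f) y, ?_⟩⟩, fun x x' h => ?_⟩,
    fun ⟨h₁, h₂⟩ => ?_⟩
  · have := congrArg (Hom.toFun (inv f)) h
    rwa [← comp_toFun, ← comp_toFun, IsIso.hom_inv_id] at this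
  · rw [← comp_toFun, IsIso.inv_hom_id, id_toFun]
  · have := Hom.map_rel (inv f) _ _ h
    rwa [← comp_toFun, ← comp_toFun, IsIso.hom_inv_id] at this
  · let e := Equiv.ofBijective _ h₁
    refine ⟨homMk e.symm (fun y y' h => h₂ _ _ ?_), ?_, ?_⟩
    · change Y.rel (e (e.symm y)) (e (e.symm y'))
      simpa using h
    · ext x
      exact e.symm_apply_apply x
    · ext y
      exact e.apply_symm_apply y

/-- Constant maps from `pair` detect elements, and all maps from it detect the relation. Hence a
monomorphism through which they all factor is bijective and reflects the relation. -/
lemma isStrongGenerator_pair :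
    (ObjectProperty.singleton pair.{u}).IsStrongGenerator := by
  rw [ObjectProperty.isStrongGenerator_iff]
  have hpair : ObjectProperty.singleton pair.{u} pair := by simp
  have hsep : (ObjectProperty.singleton pair.{u}).IsSeparating := by
    intro X Y f g h
    ext x
    exact congr_toFun (h pair hpair (pairDesc x x (Setoid.refl' _ x))) ⟨false⟩
  refine ⟨hsep, fun X Y i _ hi => ?_⟩
  have hi' {y y' : Y.carrier} (h : Y.rel y y') : ∃ x x', X.rel x x' ∧ Hom.toFun i x = y ∧
      Hom.toFun i x' = y' := by
    obtain ⟨f, hf⟩ := hi pair hpair (pairDesc y y' h)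
    exact ⟨_, _, rel_of_pair f ⟨false⟩ ⟨true⟩, congr_toFun hf ⟨false⟩, congr_toFun hf ⟨true⟩⟩
  -- As a right adjoint, `forget` preserves monomorphisms.
  have hinj : Function.Injective (Hom.toFun i) := (mono_iff_injective (forget.map i)).1 inferInstance
  refine (isIso_iff i).2 ⟨⟨hinj, fun y => ?_⟩, fun x x' h => ?_⟩
  · obtain ⟨x, _, _, hx, _⟩ := hi' (Setoid.refl' _ y)
    exact ⟨x, hx⟩
  · obtain ⟨z, z', h, hz, hz'⟩ := hi' h
    rwa [hinj hz, hinj hz'] at h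

instance : IsLocallyFinitelyPresentable.{u} PartitionedSet.{u} := by
  refine (IsCardinalLocallyPresentable.iff_exists_isStrongGenerator _ _).2
    ⟨_, inferInstance, isStrongGenerator_pair, ?_⟩
  simp only [ObjectProperty.singleton_le_iff, CategoryTheory.isCardinalPresentable_iff]
  infer_instance

/-! ### Fibrations and weak equivalences by lifting -/

lemma weakEquivalence_eq :
    weakEquivalence.{u} = (MorphismProperty.isomorphisms (Type u)).inverseImage quotient := by
  ext X Y f
  exact (isIso_iff_bijective (quotient.map f)).symm

/-- This is the analogue of path lifting: an equivalence starting at an image lifts with prescribed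
starting point. -/
lemma fibration_iff {X Y : PartitionedSet.{u}} (f : X ⟶ Y) :
    fibration f ↔ ∀ (x : X.carrier) (y : Y.carrier), Y.rel (Hom.toFun f x) y →
      ∃ x', X.rel x x' ∧ Hom.toFun f x' = y := by
  refine ⟨fun hf x y h => ?_, ?_⟩
  · obtain ⟨y₀, hy₀⟩ := hf _ (X.rel.mem_classes x)
    have hx : Hom.toFun f x ∈ { y | Y.rel y y₀ } := hy₀ ▸ ⟨x, Setoid.refl' _ x, rfl⟩
    have hy : y ∈ { y | Y.rel y y₀ } := Setoid.trans' _ (Setoid.symm' _ h) hx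
    rw [← hy₀] at hy
    obtain ⟨x', hx', rfl⟩ := hy
    exact ⟨x', Setoid.symm' _ hx', rfl⟩
  · rintro hf _ ⟨x, rfl⟩
    refine ⟨Hom.toFun f x, Set.ext fun y => ⟨?_, fun h => ?_⟩⟩
    · rintro ⟨x', hx', rfl⟩
      exact Hom.map_rel f _ _ hx'
    · obtain ⟨x', hx', rfl⟩ := hf x y (Setoid.symm' _ h)
      exact ⟨x', Setoid.symm' _ hx', rfl⟩

/-- The acyclic fibrations are the surjections that reflect the equivalence relation. -/
lemma fibration_and_weakEquivalence_iff {X Y : PartitionedSet.{u}} (f : X ⟶ Y) :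
    fibration f ∧ weakEquivalence f ↔ Function.Surjective (Hom.toFun f) ∧
      ∀ x x', Y.rel (Hom.toFun f x) (Hom.toFun f x') → X.rel x x' := by
  rw [fibration_iff]
  constructor
  · rintro ⟨hf, hinj, hsurj⟩
    refine ⟨fun y => ?_, fun x x' h => Quotient.exact (hinj (Quotient.sound h))⟩
    obtain ⟨x, hx⟩ := hsurj (Quotient.mk _ y)
    induction x using Quotient.inductionOn with | _ x
    obtain ⟨x', _, hx'⟩ := hf x y (Quotient.exact hx)
    exact ⟨x', hx'⟩
  · rintro ⟨hsurj, hrel⟩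
    refine ⟨fun x y h => ?_, fun a b => ?_, fun b => ?_⟩
    · obtain ⟨x', rfl⟩ := hsurj y
      exact ⟨x', hrel _ _ h, rfl⟩
    · induction a, b using Quotient.inductionOn₂ with | _ x x'
      exact fun h => Quotient.sound (hrel _ _ (Quotient.exact h))
    · induction b using Quotient.inductionOn with | _ y
      obtain ⟨x, rfl⟩ := hsurj y
      exact ⟨Quotient.mk _ x, rfl⟩

/-- The inclusion of a point into `pair`. -/
def pointToPair : discrete.{u}.obj PUnit ⟶ pair :=
  homMk (fun _ => ⟨false⟩) (fun _ _ _ => trivial)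

/-- The inclusion of the empty set into a point. -/
def emptyToPoint : discrete.{u}.obj PEmpty ⟶ discrete.obj PUnit :=
  homMk (fun _ => PUnit.unit) (fun _ _ _ => rfl)

/-- The identity of a set with two elements, from the discrete to the indiscrete partition. -/
def discreteToPair : discrete.{u}.obj (ULift.{u} Bool) ⟶ pair :=
  homMk (fun b => b) (fun _ _ _ => trivial)

lemma hasLiftingProperty_pointToPair_iff {X Y : PartitionedSet.{u}} (f : X ⟶ Y) :
    HasLiftingProperty pointToPair f ↔ fibration f := by
  rw [fibration_iff]
  refine ⟨fun _ x y h => ?_, fun hf => ⟨fun {a b} sq => ?_⟩⟩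
  · have sq : CommSq (homMk (X := discrete.obj PUnit) (fun _ => x) (fun _ _ _ => Setoid.refl' _ x))
        pointToPair f (pairDesc _ y h) := ⟨by ext; rfl⟩
    refine ⟨Hom.toFun sq.lift ⟨true⟩, ?_, congr_toFun sq.fac_right ⟨true⟩⟩
    have := rel_of_pair sq.lift ⟨false⟩ ⟨true⟩
    rwa [show Hom.toFun sq.lift ⟨false⟩ = x from congr_toFun sq.fac_left PUnit.unit] at this
  · have hab : Hom.toFun f (Hom.toFun a PUnit.unit) = Hom.toFun b ⟨false⟩ :=
      congr_toFun sq.w PUnit.unit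
    obtain ⟨x', h, hx'⟩ := hf (Hom.toFun a PUnit.unit) (Hom.toFun b ⟨true⟩)
      (hab ▸ rel_of_pair b ⟨false⟩ ⟨true⟩)
    refine ⟨⟨⟨pairDesc _ _ h, by ext; rfl, ?_⟩⟩⟩
    ext ⟨_ | _⟩
    exacts [hab, hx']

lemma hasLiftingProperty_emptyToPoint_iff {X Y : PartitionedSet.{u}} (f : X ⟶ Y) :
    HasLiftingProperty emptyToPoint f ↔ Function.Surjective (Hom.toFun f) := by
  refine ⟨fun _ y => ?_, fun hf => ⟨fun {a b} sq => ?_⟩⟩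
  · have sq : CommSq (homMk (X := discrete.obj PEmpty) (Y := X) PEmpty.elim (fun x => x.elim))
        emptyToPoint f (homMk (X := discrete.obj PUnit) (fun _ => y)
          (fun _ _ _ => Setoid.refl' _ y)) := ⟨by ext x; exact x.elim⟩
    exact ⟨Hom.toFun sq.lift PUnit.unit, congr_toFun sq.fac_right PUnit.unit⟩
  · obtain ⟨x, hx⟩ := hf (Hom.toFun b PUnit.unit)
    refine ⟨⟨⟨homMk (fun _ => x) (fun _ _ _ => Setoid.refl' _ x), by ext x; exact x.elim, ?_⟩⟩⟩
    ext
    exact hx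

lemma hasLiftingProperty_discreteToPair_iff {X Y : PartitionedSet.{u}} (f : X ⟶ Y) :
    HasLiftingProperty discreteToPair f ↔
      ∀ x x', Y.rel (Hom.toFun f x) (Hom.toFun f x') → X.rel x x' := by
  refine ⟨fun _ x x' h => ?_, fun hf => ⟨fun {a b} sq => ?_⟩⟩
  · have sq : CommSq (homMk (X := discrete.obj (ULift.{u} Bool)) (fun b => bif b.down then x' else x)
        (by rintro b _ rfl; exact Setoid.refl' _ _)) discreteToPair f (pairDesc _ _ h) :=
      ⟨by ext ⟨_ | _⟩ <;> rfl⟩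
    have := rel_of_pair sq.lift ⟨false⟩ ⟨true⟩
    rwa [show Hom.toFun sq.lift ⟨false⟩ = x from congr_toFun sq.fac_left ⟨false⟩,
      show Hom.toFun sq.lift ⟨true⟩ = x' from congr_toFun sq.fac_left ⟨true⟩] at this
  -- `discreteToPair` is the identity on elements, so the lift must be `a` itself; only
  -- compatibility with the relation is at stake.
  · refine ⟨⟨⟨homMk (Hom.toFun (X := discrete.obj _) a) (fun z z' _ => hf _ _ ?_), rfl, ?_⟩⟩⟩
    · exact rel_congr (congr_toFun sq.w z) (congr_toFun sq.w z') (rel_of_pair b z z')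
    · ext z
      exact congr_toFun sq.w z

lemma fibration_discrete_map {S T : Type u} (f : S ⟶ T) : fibration (discrete.map f) := by
  rw [fibration_iff]
  rintro x _ rfl
  exact ⟨x, rfl, rfl⟩

/-- The pullback of a weak equivalence along a fibration is a weak equivalence. -/
lemma weakEquivalence_of_isPullback {X Y X' Y' : PartitionedSet.{u}} {f' : X' ⟶ Y'} {q : X' ⟶ X}
    {p : Y' ⟶ Y} {f : X ⟶ Y} (sq : IsPullback f' q p f) (hf : weakEquivalence f)
    (hp : fibration p) : weakEquivalence f' := by
  rw [fibration_iff] at hp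
  -- Mapping `pair` into the pullback yields its elements and its relation from the universal
  -- property alone.
  have hlift {y y' : Y'.carrier} {x x' : X.carrier} (hy : Y'.rel y y') (hx : X.rel x x')
      (h : Hom.toFun p y = Hom.toFun f x) (h' : Hom.toFun p y' = Hom.toFun f x') :
      ∃ z z', X'.rel z z' ∧ Hom.toFun f' z = y ∧ Hom.toFun f' z' = y' ∧
        Hom.toFun q z = x ∧ Hom.toFun q z' = x' := by
    have w : pairDesc y y' hy ≫ p = pairDesc x x' hx ≫ f := by
      ext ⟨_ | _⟩
      exacts [h, h']
    exact ⟨_, _, rel_of_pair (sq.lift _ _ w) ⟨false⟩ ⟨true⟩,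
      congr_toFun (sq.lift_fst _ _ w) ⟨false⟩, congr_toFun (sq.lift_fst _ _ w) ⟨true⟩,
      congr_toFun (sq.lift_snd _ _ w) ⟨false⟩, congr_toFun (sq.lift_snd _ _ w) ⟨true⟩⟩
  have hw (z) : Hom.toFun p (Hom.toFun f' z) = Hom.toFun f (Hom.toFun q z) := congr_toFun sq.w z
  have hext {z z' : X'.carrier} (h₁ : Hom.toFun f' z = Hom.toFun f' z')
      (h₂ : Hom.toFun q z = Hom.toFun q z') : z = z' := by
    have h : pairDesc z z (Setoid.refl' _ z) = pairDesc z' z' (Setoid.refl' _ z') :=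
      sq.hom_ext (by ext ⟨_ | _⟩ <;> exact h₁) (by ext ⟨_ | _⟩ <;> exact h₂)
    exact congr_toFun h ⟨false⟩
  constructor
  · intro a b
    induction a, b using Quotient.inductionOn₂ with | _ z z'
    intro h
    have hy : Y'.rel (Hom.toFun f' z) (Hom.toFun f' z') := Quotient.exact h
    have hx : X.rel (Hom.toFun q z) (Hom.toFun q z') := by
      refine Quotient.exact (hf.1 (Quotient.sound ?_))
      change Y.rel _ _
      rw [← hw, ← hw]
      exact Hom.map_rel p _ _ hy
    obtain ⟨a, a', haa', h₁, h₂, h₃, h₄⟩ := hlift hy hx (hw z) (hw z')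
    obtain rfl := hext h₁ h₃
    obtain rfl := hext h₂ h₄
    exact Quotient.sound haa'
  · intro b
    induction b using Quotient.inductionOn with | _ y
    obtain ⟨x, hx⟩ := hf.2 (Quotient.mk _ (Hom.toFun p y))
    induction x using Quotient.inductionOn with | _ x
    -- The fibration moves `y` within its class to a point lying exactly over the image of `x`.
    obtain ⟨y', hy', h⟩ := hp y (Hom.toFun f x) (Setoid.symm' _ (Quotient.exact hx))
    obtain ⟨z, _, _, rfl, _⟩ := hlift (Setoid.refl' _ y') (Setoid.refl' _ x) h h
    exact ⟨Quotient.mk _ z, Quotient.sound (Setoid.symm' _ hy')⟩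

end PartitionedSet

/-! ### Transport of generators to functor categories -/

section FreeFunctors

universe u₁ t

variable {A : Type t} [Category.{u} A] [HasColimitsOfSize.{u, u} A]
  {K : Type u} [SmallCategory K] {ι : Type u₁} {X Y : ι → A}

/-- The morphisms obtained by applying the left adjoints of all the evaluation functors to a
family of morphisms. -/
abbrev freeMorphisms (K : Type u) [SmallCategory K] (i : ∀ k, X k ⟶ Y k) :
    MorphismProperty (K ⥤ A) :=
  MorphismProperty.ofHoms fun p : K × ι => (evaluationLeftAdjoint A p.1).map (i p.2)

lemma rlp_freeMorphisms (i : ∀ k, X k ⟶ Y k) :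
    (freeMorphisms K i).rlp = MorphismProperty.functorCategory (.rlp (.ofHoms i)) K := by
  ext _ _ f
  refine ⟨fun hf c => ?_, fun hf => ?_⟩
  · rintro _ _ _ ⟨k⟩
    exact ((evaluationAdjunctionRight A c).hasLiftingProperty_iff _ _).1
      (hf _ (MorphismProperty.ofHoms_iff _ _ |>.2 ⟨(c, k), rfl⟩))
  · rintro _ _ _ ⟨c, k⟩
    exact ((evaluationAdjunctionRight A c).hasLiftingProperty_iff _ _).2 (hf c _ ⟨k⟩)

attribute [local instance] Cardinal.fact_isRegular_aleph0

/-- Evaluation preserves colimits, so its left adjoint preserves finitely presentable objects. -/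
lemma isFinitelyPresentable_of_freeMorphisms (i : ∀ k, X k ⟶ Y k)
    [∀ k, IsFinitelyPresentable.{u} (X k)] ⦃F G : K ⥤ A⦄ (f : F ⟶ G)
    (hf : freeMorphisms K i f) : IsFinitelyPresentable.{u} F := by
  obtain ⟨c, k⟩ := hf
  exact (evaluationAdjunctionRight A c).isCardinalPresentable_leftAdjoint_obj _ _

end FreeFunctors

/-! ### Smallness from finite presentability -/

section SmallObjectArgument

universe t

variable {D : Type t} [Category.{u} D]

attribute [local instance] Cardinal.fact_isRegular_aleph0 Cardinal.orderBotAleph0OrdToType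

lemma isSmallRelativeTo_of_isFinitelyPresentable (A : D) [IsFinitelyPresentable.{u} A]
    (P : MorphismProperty D) : IsSmallRelativeTo A P := by
  refine ⟨Cardinal.aleph0, fun μ hμ _ F _ _ => ?_⟩
  -- A nonempty linear order is filtered, so the colimit of the sequence is a filtered colimit.
  have : Nonempty μ.ord.ToType := by
    rw [Ordinal.nonempty_toType_iff, ne_eq, Cardinal.ord_eq_zero]
    exact hμ.pos.ne'
  infer_instance

lemma permitsSmallObjectArgument_of_isFinitelyPresentable (I : MorphismProperty D)
    (hI : ∀ ⦃A B : D⦄ (i : A ⟶ B), I i → IsFinitelyPresentable.{u} A) :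
    PermitsSmallObjectArgument I := fun A _ i hi =>
  have := hI i hi
  isSmallRelativeTo_of_isFinitelyPresentable A _

lemma hasSmallObjectArgument_of_isFinitelyPresentable [HasColimitsOfSize.{u, u} D]
    (I : MorphismProperty D) [MorphismProperty.IsSmall.{u} I]
    (hI : ∀ ⦃A B : D⦄ (i : A ⟶ B), I i → IsFinitelyPresentable.{u} A) :
    MorphismProperty.HasSmallObjectArgument.{u} I where
  exists_cardinal :=
    ⟨.aleph0, inferInstance, inferInstance,
      { preservesColimit i hi f hf := by
          have := hI i hi
          infer_instance }⟩

end SmallObjectArgument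

/-! ### Generating sets for diagrams -/

namespace PartitionedSet

variable (K : Type u) [SmallCategory K]

/-- The morphisms that detect acyclic fibrations of partitioned sets. -/
def generatingCofibration : ∀ b : Bool,
    (discrete.{u}.obj (bif b then PEmpty else ULift.{u} Bool)) ⟶
      (bif b then discrete.obj PUnit else pair)
  | true => emptyToPoint
  | false => discreteToPair

/-- The morphism that detects fibrations of partitioned sets. -/
def generatingTrivialCofibration (_ : Unit) : discrete.{u}.obj PUnit ⟶ pair := pointToPair

lemma fibration_and_weakEquivalence_eq_rlp :
    fibration.{u} ⊓ weakEquivalence = MorphismProperty.rlp (.ofHoms generatingCofibration) := by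
  ext X Y f
  refine (fibration_and_weakEquivalence_iff f).trans ⟨?_, fun h => ⟨?_, ?_⟩⟩
  · rintro ⟨h₁, h₂⟩ _ _ _ ⟨_ | _⟩
    · exact (hasLiftingProperty_discreteToPair_iff f).2 h₂
    · exact (hasLiftingProperty_emptyToPoint_iff f).2 h₁
  · exact (hasLiftingProperty_emptyToPoint_iff f).1
      (h _ (MorphismProperty.ofHoms_iff _ _ |>.2 ⟨true, rfl⟩))
  · exact (hasLiftingProperty_discreteToPair_iff f).1
      (h _ (MorphismProperty.ofHoms_iff _ _ |>.2 ⟨false, rfl⟩))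

lemma fibration_eq_rlp :
    fibration.{u} = MorphismProperty.rlp (.ofHoms generatingTrivialCofibration) := by
  ext X Y f
  refine (hasLiftingProperty_pointToPair_iff f).symm.trans ⟨?_, fun h => ?_⟩
  · rintro h _ _ _ ⟨_⟩
    exact h
  · exact h _ (MorphismProperty.ofHoms_iff _ _ |>.2 ⟨(), rfl⟩)

/-- Objectwise weak equivalences are the morphisms inverted by the objectwise quotient. -/
lemma functorCategory_weakEquivalence_eq :
    weakEquivalence.{u}.functorCategory K =
      (MorphismProperty.isomorphisms (K ⥤ Type u)).inverseImage
        ((Functor.whiskeringRight K _ _).obj quotient) := by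
  rw [← MorphismProperty.functorCategory_isomorphisms, weakEquivalence_eq]
  rfl

/-- The generating cofibrations of diagrams of partitioned sets. -/
abbrev diagramGeneratingCofibrations : MorphismProperty (K ⥤ PartitionedSet.{u}) :=
  freeMorphisms K generatingCofibration

/-- The generating acyclic cofibrations of diagrams of partitioned sets. -/
abbrev diagramGeneratingTrivialCofibrations : MorphismProperty (K ⥤ PartitionedSet.{u}) :=
  freeMorphisms K generatingTrivialCofibration

lemma isFinitelyPresentable_of_diagramGeneratingCofibrations ⦃F G : K ⥤ PartitionedSet.{u}⦄
    (f : F ⟶ G) (hf : diagramGeneratingCofibrations K f) : IsFinitelyPresentable.{u} F := by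
  have (b : Bool) : Finite (bif b then PEmpty.{u + 1} else ULift.{u} Bool) := by
    cases b
    exacts [inferInstanceAs (Finite (ULift Bool)), inferInstanceAs (Finite PEmpty)]
  exact isFinitelyPresentable_of_freeMorphisms _ _ hf

lemma isFinitelyPresentable_of_diagramGeneratingTrivialCofibrations
    ⦃F G : K ⥤ PartitionedSet.{u}⦄ (f : F ⟶ G) (hf : diagramGeneratingTrivialCofibrations K f) :
    IsFinitelyPresentable.{u} F :=
  isFinitelyPresentable_of_freeMorphisms _ _ hf

instance : MorphismProperty.HasSmallObjectArgument.{u} (diagramGeneratingCofibrations K) :=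
  hasSmallObjectArgument_of_isFinitelyPresentable _
    (isFinitelyPresentable_of_diagramGeneratingCofibrations K)

instance : MorphismProperty.HasSmallObjectArgument.{u} (diagramGeneratingTrivialCofibrations K) :=
  hasSmallObjectArgument_of_isFinitelyPresentable _
    (isFinitelyPresentable_of_diagramGeneratingTrivialCofibrations K)

lemma rlp_diagramGeneratingCofibrations :
    (diagramGeneratingCofibrations K).rlp =
      fibration.functorCategory K ⊓ weakEquivalence.functorCategory K := by
  rw [rlp_freeMorphisms, ← fibration_and_weakEquivalence_eq_rlp]
  ext F G f
  exact forall_and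

lemma rlp_diagramGeneratingTrivialCofibrations :
    (diagramGeneratingTrivialCofibrations K).rlp = fibration.functorCategory K := by
  rw [rlp_freeMorphisms, ← fibration_eq_rlp]

/-- A morphism with the left lifting property with respect to fibrations is a weak equivalence:
its image under the objectwise quotient has the left lifting property with respect to every
morphism, since the discrete functor takes every morphism to a fibration. -/
lemma llp_fibration_le_weakEquivalence :
    (fibration.{u}.functorCategory K).llp ≤ weakEquivalence.functorCategory K := by
  intro F G f hf
  rw [functorCategory_weakEquivalence_eq]
  let Q := (Functor.whiskeringRight K _ _).obj quotient.{u}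
  let adj := quotientAdjunction.{u}.whiskerRight K
  have : HasLiftingProperty (Q.map f) (Q.map f) :=
    (adj.hasLiftingProperty_iff f (Q.map f)).2 (hf _ fun c => fibration_discrete_map _)
  -- A diagonal of this square is a two-sided inverse of `Q.map f`.
  have sq : CommSq (𝟙 _) (Q.map f) (Q.map f) (𝟙 _) := ⟨by simp⟩
  exact ⟨sq.lift, sq.fac_left, sq.fac_right⟩

/-- Diagrams of partitioned sets with the objectwise fibrations. -/
abbrev diagramFibrations : CategoryWithFibrations (K ⥤ PartitionedSet.{u}) :=
  ⟨fibration.functorCategory K⟩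

/-- Diagrams of partitioned sets with the objectwise weak equivalences. -/
abbrev diagramWeakEquivalences : CategoryWithWeakEquivalences (K ⥤ PartitionedSet.{u}) :=
  ⟨weakEquivalence.functorCategory K⟩

/-- Diagrams of partitioned sets with the cofibrations defined by the left lifting property with
respect to acyclic fibrations. -/
abbrev diagramCofibrations : CategoryWithCofibrations (K ⥤ PartitionedSet.{u}) :=
  ⟨(fibration.functorCategory K ⊓ weakEquivalence.functorCategory K).llp⟩

/-! ### The model structure -/

section ModelCategory

attribute [local instance] diagramFibrations diagramWeakEquivalences diagramCofibrations

lemma diagram_trivialFibrations_eq :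
    trivialFibrations (K ⥤ PartitionedSet.{u}) = (diagramGeneratingCofibrations K).rlp :=
  (rlp_diagramGeneratingCofibrations K).symm

lemma diagram_fibrations_eq :
    fibrations (K ⥤ PartitionedSet.{u}) = (diagramGeneratingTrivialCofibrations K).rlp :=
  (rlp_diagramGeneratingTrivialCofibrations K).symm

lemma diagram_cofibrations_eq :
    cofibrations (K ⥤ PartitionedSet.{u}) = (diagramGeneratingCofibrations K).rlp.llp := by
  rw [rlp_diagramGeneratingCofibrations]
  rfl

instance diagram_hasTwoOutOfThreeProperty :
    (weakEquivalences (K ⥤ PartitionedSet.{u})).HasTwoOutOfThreeProperty := by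
  change (weakEquivalence.functorCategory K).HasTwoOutOfThreeProperty
  rw [functorCategory_weakEquivalence_eq]
  infer_instance

lemma diagram_trivialCofibrations_eq :
    trivialCofibrations (K ⥤ PartitionedSet.{u}) =
      (diagramGeneratingTrivialCofibrations K).rlp.llp := by
  rw [← diagram_fibrations_eq]
  apply le_antisymm
  · rintro F G f ⟨hf, hf'⟩
    -- Retract argument: two-out-of-three makes `h.p` an acyclic fibration, so the cofibration `f`
    -- lifts against it and is a retract of `h.i`.
    let h := MorphismProperty.factorizationData
      (diagramGeneratingTrivialCofibrations K).rlp.llp (diagramGeneratingTrivialCofibrations K).rlp f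
    have hi : (fibrations (K ⥤ PartitionedSet.{u})).llp h.i := by
      rw [diagram_fibrations_eq]
      exact h.hi
    have hp : fibrations (K ⥤ PartitionedSet.{u}) h.p := by
      rw [diagram_fibrations_eq]
      exact h.hp
    have hi' : weakEquivalences _ h.i := llp_fibration_le_weakEquivalence K _ hi
    have hp' : weakEquivalences _ h.p :=
      MorphismProperty.of_precomp _ h.i h.p hi' (by rwa [h.fac])
    have : HasLiftingProperty f h.p := hf _ ⟨hp, hp'⟩
    exact MorphismProperty.of_retract (RetractArrow.ofLeftLiftingProperty h.fac) hi
  · intro F G f hf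
    exact ⟨MorphismProperty.antitone_llp inf_le_left f hf,
      llp_fibration_le_weakEquivalence K f hf⟩

instance diagram_hasFunctorialFactorization_cofibrations_trivialFibrations :
    MorphismProperty.HasFunctorialFactorization (cofibrations (K ⥤ PartitionedSet.{u}))
      (trivialFibrations (K ⥤ PartitionedSet.{u})) := by
  rw [diagram_cofibrations_eq, diagram_trivialFibrations_eq]
  infer_instance

instance diagram_hasFunctorialFactorization_trivialCofibrations_fibrations :
    MorphismProperty.HasFunctorialFactorization (trivialCofibrations (K ⥤ PartitionedSet.{u}))
      (fibrations (K ⥤ PartitionedSet.{u})) := by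
  rw [diagram_trivialCofibrations_eq, diagram_fibrations_eq]
  infer_instance

instance diagram_isWeakFactorizationSystem_cofibrations_trivialFibrations :
    MorphismProperty.IsWeakFactorizationSystem (cofibrations (K ⥤ PartitionedSet.{u}))
      (trivialFibrations (K ⥤ PartitionedSet.{u})) where
  rlp := by
    rw [diagram_cofibrations_eq, diagram_trivialFibrations_eq, MorphismProperty.rlp_llp_rlp]
  llp := by rw [diagram_cofibrations_eq, diagram_trivialFibrations_eq]

instance diagram_isWeakFactorizationSystem_trivialCofibrations_fibrations :
    MorphismProperty.IsWeakFactorizationSystem (trivialCofibrations (K ⥤ PartitionedSet.{u}))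
      (fibrations (K ⥤ PartitionedSet.{u})) where
  rlp := by
    rw [diagram_trivialCofibrations_eq, diagram_fibrations_eq, MorphismProperty.rlp_llp_rlp]
  llp := by rw [diagram_trivialCofibrations_eq, diagram_fibrations_eq]

/-- The model structure on diagrams of partitioned sets with objectwise weak equivalences and
fibrations. -/
abbrev diagramModelCategory : ModelCategory (K ⥤ PartitionedSet.{u}) :=
  ModelCategory.mk' _

end ModelCategory

/-! ### Properness and cofibrant generation -/

section Properties

attribute [local instance] diagramModelCategory

lemma diagram_isLeftProper : IsLeftProper (K ⥤ PartitionedSet.{u}) := by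
  intro A B A' B' f i j f' sq hf _
  change weakEquivalence.functorCategory K f at hf
  change weakEquivalence.functorCategory K f'
  rw [functorCategory_weakEquivalence_eq] at hf ⊢
  have := (quotientAdjunction.{u}.whiskerRight K).isLeftAdjoint
  exact MorphismProperty.of_isPushout (P := MorphismProperty.isomorphisms _)
    (sq.map ((Functor.whiskeringRight K _ _).obj quotient.{u})).flip hf

/-- Evaluation preserves pullbacks, which reduces the claim to partitioned sets. -/
lemma diagram_isRightProper : IsRightProper (K ⥤ PartitionedSet.{u}) :=
  fun _ _ _ _ _ _ _ _ sq hf hp c =>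
    weakEquivalence_of_isPullback (sq.map ((evaluation _ _).obj c)) (hf c) (hp c)

lemma diagram_isCofibrantlyGenerated : IsCofibrantlyGenerated (K ⥤ PartitionedSet.{u}) :=
  ⟨⟨_, inferInstance, permitsSmallObjectArgument_of_isFinitelyPresentable _
      (isFinitelyPresentable_of_diagramGeneratingCofibrations K),
      diagram_trivialFibrations_eq K⟩,
    ⟨_, inferInstance, permitsSmallObjectArgument_of_isFinitelyPresentable _
      (isFinitelyPresentable_of_diagramGeneratingTrivialCofibrations K),
      diagram_fibrations_eq K⟩⟩

end Properties

end PartitionedSet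

/-- Limits and colimits of small diagrams and functorial factorizations are part of the notion of
model category used here, in addition to the axioms of `ModelCategory`. -/
theorem corollary3p5 (C : Type u) [SmallCategory C] :
    ∃ _ : ModelCategory (Cᵒᵖ ⥤ PartitionedSet.{u}),
      weakEquivalences (Cᵒᵖ ⥤ PartitionedSet.{u}) =
        PartitionedSet.weakEquivalence.functorCategory Cᵒᵖ ∧
      fibrations (Cᵒᵖ ⥤ PartitionedSet.{u}) =
        PartitionedSet.fibration.functorCategory Cᵒᵖ ∧
      cofibrations (Cᵒᵖ ⥤ PartitionedSet.{u}) =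
        (trivialFibrations (Cᵒᵖ ⥤ PartitionedSet.{u})).llp ∧
      HasLimits (Cᵒᵖ ⥤ PartitionedSet.{u}) ∧
      HasColimits (Cᵒᵖ ⥤ PartitionedSet.{u}) ∧
      MorphismProperty.HasFunctorialFactorization
        (cofibrations (Cᵒᵖ ⥤ PartitionedSet.{u}))
        (trivialFibrations (Cᵒᵖ ⥤ PartitionedSet.{u})) ∧
      MorphismProperty.HasFunctorialFactorization
        (trivialCofibrations (Cᵒᵖ ⥤ PartitionedSet.{u}))
        (fibrations (Cᵒᵖ ⥤ PartitionedSet.{u})) ∧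
      IsProperModelStructure (Cᵒᵖ ⥤ PartitionedSet.{u}) ∧
      IsCofibrantlyGenerated (Cᵒᵖ ⥤ PartitionedSet.{u}) ∧
      IsLocallyFinitelyPresentable.{u} (Cᵒᵖ ⥤ PartitionedSet.{u}) ∧
      IsCombinatorial (Cᵒᵖ ⥤ PartitionedSet.{u}) := by
  have := Cardinal.fact_isRegular_aleph0.{u}
  have hlfp : IsLocallyFinitelyPresentable.{u} (Cᵒᵖ ⥤ PartitionedSet.{u}) := inferInstance
  exact ⟨PartitionedSet.diagramModelCategory Cᵒᵖ, rfl, rfl, rfl, inferInstance, inferInstance,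
    PartitionedSet.diagram_hasFunctorialFactorization_cofibrations_trivialFibrations Cᵒᵖ,
    PartitionedSet.diagram_hasFunctorialFactorization_trivialCofibrations_fibrations Cᵒᵖ,
    ⟨PartitionedSet.diagram_isLeftProper Cᵒᵖ, PartitionedSet.diagram_isRightProper Cᵒᵖ⟩,
    PartitionedSet.diagram_isCofibrantlyGenerated Cᵒᵖ, hlfp, ⟨⟨_, _, hlfp⟩⟩,
    PartitionedSet.diagram_isCofibrantlyGenerated Cᵒᵖ⟩
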